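/- **Model.** A sender and a receiver are connected by $n$ channels and have no other means of communication (no public channel). A protocol $\Pi$ with finite non-empty message space $\mathcal M$ has a fixed number of rounds; in each round the party scheduled to speak (sender or receiver) sends, on each channel, a packet (possibly empty, possibly containing the special message DETECT) depending on its private random coins, on what it has received so far and, for the sender, on the message $M_S\in\mathcal M$ to be transmitted. At the end the receiver outputs $M_R\in\mathcal M$ or nothing. A $t$-adversary uses its own random coins to choose at most $t$ channels to corrupt; in every round, after seeing what is sent on the corrupted channels, it replaces the packets on them by packets of its choice; at the end it outputs some $M_A\in\mathcal M$. It is computationally unbounded, and the coins of the three are independent. $\Pi$ is $(0,0)$-SMT against an adversary $\mathcal B$ if (correctness) for every $m$, whenever $\mathcal B$ changes no messages, $\Pr[M_R=m]=1$ for $M_S=m$; (privacy) for all $m_0,m_1\in\mathcal M$ and all fixed coins of $\mathcal B$, the sequences of packets sent over the corrupted channels for $M_S=m_0$ and for $M_S=m_1$ have statistical distance $0$; (reliability) for every $m$, $\Pr[M_R\ne m]=0$ for $M_S=m$. In the SMT game, $M_S$ is uniformly random in $\mathcal M$ and $\Pi$ is run with the adversary. Put $\mathsf{guess}=1$ iff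 $M_A=M_S$; $\mathsf{suc}=1$ iff $M_R=M_S$; $\mathsf{detect}=1$ iff the sender or the receiver sends DETECT at some time (and $0$ otherwise). For $U:\{0,1\}^3\to\mathbb R$ let $u(\mathcal A,U)=\mathbb E[U(\mathsf{guess},\mathsf{suc},\mathsf{detect})]$. $\Pi$ is perfectly secure against a rational $t$-adversary with utility function $U$ if there is a $t$-adversary $\mathcal B$ such that $\Pi$ is $(0,0)$-SMT against $\mathcal B$ and $u(\mathcal A,U)\le u(\mathcal B,U)$ for every $t$-adversary $\mathcal A$. $U$ is timid if $U(g,0,d)>U(g,1,d)$ and $U(g,s,0)>U(g,s,1)$ for all $g,s,d\in\{0,1\}$. For $s,d\in\{0,1\}$ let $w_{s,d}=\frac1{|\mathcal M|}U(1,s,d)+\bigl(1-\frac1{|\mathcal M|}\bigr)U(0,s,d)$, and put $u_2=w_{1,0}$, $u_3=w_{0,1}$, $u_4=w_{1,1}$. **Theorem.** Let $\Pi$ be a protocol as above (without public channel) that is perfectly secure against a rational $t$-adversary with a timid utility function $U$ such that $u_4\ge 0$. If $$u_2<\frac12\Bigl(1-\frac1{|\mathcal M|}\Bigr)u_3,$$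 then $t<n/2$. -/

import Mathlib

namespace SMT

/-- The two honest parties. -/
inductive Party where
  | sender
  | receiver
  deriving DecidableEq

/-- What travels over one channel in one round: an optional payload (`none` is the empty or
blocked transmission) and possibly the special message "DETECT" sent along with it. -/
structure Packet (Msg : Type) where
  payload : Option Msg
  detect : Bool

/-- The contents of all `n` channels in one round. -/
abbrev Row (n : ℕ) (Msg : Type) : Type := Fin n → Packet Msg

/-- One round of an execution: who speaks, what that party puts on the channels, and what
arrives at the other end. -/
structure Exchange (n : ℕ) (Msg : Type) where
  speaker : Party
  sent : Row n Msg
  delivered : Row n Msg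

/-- What party `p` has received so far: the rows delivered in the rounds in which the other
party was speaking, in chronological order. -/
def heard {n : ℕ} {Msg : Type} (p : Party) (T : List (Exchange n Msg)) : List (Row n Msg) :=
  (T.filter fun e => e.speaker ≠ p).map fun e => e.delivered

/-- A protocol (with message space `M`, over `n` channels carrying packets over `Msg`) between a
sender and a receiver who have no other means of communication; in particular there is no public
channel. The private random coins of the parties have arbitrary discrete distributions. In each
round (numbered from `0`) the scheduled speaker sends packets which depend on its coins, the
round number, the rows it received earlier, and, for the sender, the message to be transmitted.
At the end, the receiver outputs a message, or nothing (`none`). -/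
structure Protocol (M Msg : Type) (n : ℕ) where
  rounds : ℕ
  speaker : ℕ → Party
  SCoin : Type
  sCoin : PMF SCoin
  RCoin : Type
  rCoin : PMF RCoin
  sSend : M → SCoin → ℕ → List (Row n Msg) → Row n Msg
  rSend : RCoin → ℕ → List (Row n Msg) → Row n Msg
  output : RCoin → List (Row n Msg) → Option M

/-- What an adversary sees of a round: the packets sent over the corrupted channels
(`none` at the other channels). -/
abbrev Glimpse (n : ℕ) (Msg : Type) : Type := Fin n → Option (Packet Msg)

/-- The restriction of a row to a set of channels. -/
def glimpse {n : ℕ} {Msg : Type} (I : Finset (Fin n)) (x : Row n Msg) : Glimpse n Msg :=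
  fun i => if i ∈ I then some (x i) else none

/-- A computationally unbounded rushing `t`-adversary. From its random coins it chooses at most
`t` channels to corrupt. In each round, given what was sent over the corrupted channels up to and
including this round, it decides by `tamper` what arrives on them (the values of `tamper` at other
channels are never used). At the end it outputs a guess of the transmitted message. -/
structure Adversary (M Msg : Type) (n t : ℕ) where
  Coin : Type
  coin : PMF Coin
  corrupt : Coin → Finset (Fin n)
  card_corrupt_le : ∀ r, (corrupt r).card ≤ t
  tamper : Coin → List (Glimpse n Msg) → Row n Msg
  guess : Coin → List (Glimpse n Msg) → M

section Execution

variable {M Msg : Type} {n t : ℕ}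

/-- What the speaker of round `j` sends, after the execution `T` of the earlier rounds. -/
def Protocol.send (P : Protocol M Msg n) (m : M) (rS : P.SCoin) (rR : P.RCoin) (j : ℕ)
    (T : List (Exchange n Msg)) : Row n Msg :=
  match P.speaker j with
  | .sender => P.sSend m rS j (heard .sender T)
  | .receiver => P.rSend rR j (heard .receiver T)

/-- The messages sent over the corrupted channels during the execution `T`. -/
def Adversary.view (A : Adversary M Msg n t) (rA : A.Coin) (T : List (Exchange n Msg)) :
    List (Glimpse n Msg) :=
  T.map fun e => glimpse (A.corrupt rA) e.sent

/-- What arrives when `x` is sent after the execution `T` of the earlier rounds. -/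
def Adversary.deliver (A : Adversary M Msg n t) (rA : A.Coin) (T : List (Exchange n Msg))
    (x : Row n Msg) : Row n Msg :=
  fun i => if i ∈ A.corrupt rA then
    A.tamper rA (A.view rA T ++ [glimpse (A.corrupt rA) x]) i else x i

/-- The first `k` rounds of the execution on message `m` with the given random coins, in
chronological order. -/
def run (P : Protocol M Msg n) (A : Adversary M Msg n t) (m : M) (rS : P.SCoin) (rR : P.RCoin)
    (rA : A.Coin) : ℕ → List (Exchange n Msg)
  | 0 => []
  | k + 1 =>
    let T := run P A m rS rR rA k
    let x := P.send m rS rR k T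
    T ++ [⟨P.speaker k, x, A.deliver rA T x⟩]

/-- The complete execution. -/
def exec (P : Protocol M Msg n) (A : Adversary M Msg n t) (m : M) (rS : P.SCoin) (rR : P.RCoin)
    (rA : A.Coin) : List (Exchange n Msg) :=
  run P A m rS rR rA P.rounds

/-- The receiver's output `M_R`. -/
def received (P : Protocol M Msg n) (A : Adversary M Msg n t) (m : M) (rS : P.SCoin)
    (rR : P.RCoin) (rA : A.Coin) : Option M :=
  P.output rR (heard .receiver (exec P A m rS rR rA))

/-- The adversary's output `M_A`. -/
def guessed (P : Protocol M Msg n) (A : Adversary M Msg n t) (m : M) (rS : P.SCoin)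
    (rR : P.RCoin) (rA : A.Coin) : M :=
  A.guess rA (A.view rA (exec P A m rS rR rA))

/-- Some honest party sends the special message "DETECT" during the execution. -/
def Detected (P : Protocol M Msg n) (A : Adversary M Msg n t) (m : M) (rS : P.SCoin)
    (rR : P.RCoin) (rA : A.Coin) : Prop :=
  ∃ e ∈ exec P A m rS rR rA, ∃ i, (e.sent i).detect = true

/-- The distribution of the adversary's view `V_A(m, r_A)`, for fixed coins of the adversary, over
the coins of the sender and the receiver. -/
noncomputable def viewDist (P : Protocol M Msg n) (A : Adversary M Msg n t) (m : M)
    (rA : A.Coin) : PMF (List (Glimpse n Msg)) :=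
  P.sCoin.bind fun rS => P.rCoin.bind fun rR => PMF.pure (A.view rA (exec P A m rS rR rA))

/-- The distribution of the receiver's output when the message `m` is sent, over the coins of the
sender, the receiver and the adversary. -/
noncomputable def outputDist (P : Protocol M Msg n) (A : Adversary M Msg n t) (m : M) :
    PMF (Option M) :=
  P.sCoin.bind fun rS => P.rCoin.bind fun rR => A.coin.bind fun rA =>
    PMF.pure (received P A m rS rR rA)

end Execution

/-- The statistical distance of two discrete distributions. -/
noncomputable def statDist {Ω : Type} (p q : PMF Ω) : ℝ :=
  (1 / 2) * ∑' ω, |(p ω).toReal - (q ω).toReal|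

/-- `P` is `(ε, δ)`-SMT against the adversary `A`. -/
structure IsSMTAgainst {M Msg : Type} {n t : ℕ} (P : Protocol M Msg n)
    (A : Adversary M Msg n t) (ε δ : ℝ) : Prop where
  /-- If `A` does not change the messages on the corrupted channels, the message arrives. -/
  correctness : ∀ m, (∀ rS rR rA, ∀ e ∈ exec P A m rS rR rA, e.delivered = e.sent) →
    outputDist P A m (some m) = 1
  privacy : ∀ m₀ m₁ rA, statDist (viewDist P A m₀ rA) (viewDist P A m₁ rA) ≤ ε
  reliability : ∀ m, ((outputDist P A m).toOuterMeasure {x | x ≠ some m}).toReal ≤ δ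

/-- Outcomes of the SMT game. -/
structure Outcome where
  guess : Bool
  suc : Bool
  detect : Bool
  deriving DecidableEq, Fintype

open Classical in
/-- The SMT game: a uniformly random message is transmitted in the presence of `A`. -/
noncomputable def game {M Msg : Type} [Fintype M] [Nonempty M] {n t : ℕ} (P : Protocol M Msg n)
    (A : Adversary M Msg n t) : PMF Outcome :=
  (PMF.uniformOfFintype M).bind fun m =>
    P.sCoin.bind fun rS => P.rCoin.bind fun rR => A.coin.bind fun rA =>
      PMF.pure
        { guess := decide (guessed P A m rS rR rA = m)
          suc := decide (received P A m rS rR rA = some m)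
          detect := decide (Detected P A m rS rR rA) }

/-- The utility `u(A, U)`: the expected value of `U` at the outcome of the SMT game. -/
noncomputable def utility {M Msg : Type} [Fintype M] [Nonempty M] {n t : ℕ}
    (P : Protocol M Msg n) (A : Adversary M Msg n t) (U : Outcome → ℝ) : ℝ :=
  ∑ o : Outcome, (game P A o).toReal * U o

/-- `P` is perfectly secure against a rational `t`-adversary with utility function `U`. -/
def PerfectlySecureAgainstRational {M Msg : Type} [Fintype M] [Nonempty M] {n : ℕ}
    (P : Protocol M Msg n) (t : ℕ) (U : Outcome → ℝ) : Prop :=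
  ∃ B : Adversary M Msg n t, IsSMTAgainst P B 0 0 ∧
    ∀ A : Adversary M Msg n t, utility P A U ≤ utility P B U

/-- The utility functions of timid adversaries (`false < true` in `Bool`). -/
structure IsTimid (U : Outcome → ℝ) : Prop where
  prefers_failure : ∀ o o' : Outcome,
    o.guess = o'.guess → o.suc < o'.suc → o.detect = o'.detect → U o' < U o
  prefers_undetected : ∀ o o' : Outcome,
    o.guess = o'.guess → o.suc = o'.suc → o.detect < o'.detect → U o' < U o

/-- The expected utility when `Pr[guess = 1] = 1 / |M|` and `suc`, `detect` are fixed. -/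
noncomputable def utilityAt (M : Type) [Fintype M] (U : Outcome → ℝ) (suc detect : Bool) : ℝ :=
  (1 / (Fintype.card M : ℝ)) * U ⟨true, suc, detect⟩
    + (1 - 1 / (Fintype.card M : ℝ)) * U ⟨false, suc, detect⟩

/-- Utility when the receiver gets the message and nothing is detected. -/
noncomputable def u₂ (M : Type) [Fintype M] (U : Outcome → ℝ) : ℝ := utilityAt M U true false

/-- Utility when the receiver does not get the message and tampering is detected. -/
noncomputable def u₃ (M : Type) [Fintype M] (U : Outcome → ℝ) : ℝ := utilityAt M U false true

/-- Utility when the receiver gets the message and tampering is detected. -/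
noncomputable def u₄ (M : Type) [Fintype M] (U : Outcome → ℝ) : ℝ := utilityAt M U true true

end SMT

/-! Suppose `n ≤ 2 * t`. The channels then split into two sides of at most `t` each, and an
adversary may corrupt a random side, run there an independent copy of the sender with a fresh
uniform message, and block the receiver's packets on that side. Exchange the true sender with the
simulated one and flip the side: the receiver hears exactly the same rows
(`heard_run_eq_of_impersonation`), and the exchange preserves the distribution of the coins. The
common output cannot be correct in both runs unless the two messages coincide, so success has
probability at most `(1 + 1 / |M|) / 2` (`two_mul_expect_suc_impersonator_le`).

The impersonator's guess is an independent uniform message, so its utility averages the values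
`utilityAt`. Timidity and `0 ≤ u₄` make them all nonnegative, and at least `u₃` on failure; hence
the utility is at least `(1 / 2) * (1 - 1 / |M|) * u₃`. An adversary against which the protocol is
perfectly private and reliable earns at most `u₂` (`utility_le_u₂`). If `u₂` is below the former
bound, no such adversary can be optimal. -/

namespace SMT

/-! ### Expectations of nonnegative functions on discrete distributions -/

section Expectation

open scoped ENNReal

variable {α β : Type}

/-- The expectation of a nonnegative function. -/
noncomputable def expect (p : PMF α) (f : α → ℝ≥0∞) : ℝ≥0∞ := ∑' a, p a * f a

open Classical in
theorem apply_eq_expect (p : PMF α) (a : α) : p a = expect p fun b => if a = b then 1 else 0 := by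
  unfold expect
  rw [tsum_eq_single a] <;> simp +contextual [eq_comm]

theorem expect_pure (a : α) (f : α → ℝ≥0∞) : expect (PMF.pure a) f = f a := by
  unfold expect
  rw [tsum_eq_single a]
  · simp
  · intro b hb
    simp [PMF.pure_apply, hb]

theorem expect_add (p : PMF α) (f g : α → ℝ≥0∞) :
    (expect p fun a => f a + g a) = expect p f + expect p g := by
  simp only [expect, mul_add, ENNReal.tsum_add]

theorem expect_const_mul (p : PMF α) (c : ℝ≥0∞) (f : α → ℝ≥0∞) :
    (expect p fun a => c * f a) = c * expect p f := by
  simp only [expect, ← ENNReal.tsum_mul_left]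
  exact tsum_congr fun a => mul_left_comm _ _ _

theorem expect_const (p : PMF α) (c : ℝ≥0∞) : (expect p fun _ => c) = c := by
  simp only [expect, ENNReal.tsum_mul_right, p.tsum_coe, one_mul]

theorem expect_mono (p : PMF α) {f g : α → ℝ≥0∞} (h : ∀ a, f a ≤ g a) :
    expect p f ≤ expect p g :=
  ENNReal.tsum_le_tsum fun a => mul_le_mul_right (h a) _

/-- With values in `ℝ≥0∞` no summability is required, so independent coins can be averaged in any
order. -/
theorem expect_comm (p : PMF α) (q : PMF β) (f : α → β → ℝ≥0∞) :
    (expect p fun a => expect q fun b => f a b) = expect q fun b => expect p fun a => f a b := by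
  simp only [expect, ← ENNReal.tsum_mul_left]
  rw [ENNReal.tsum_comm]
  exact tsum_congr fun b => tsum_congr fun a => mul_left_comm _ _ _

theorem expect_bind (p : PMF α) (q : α → PMF β) (f : β → ℝ≥0∞) :
    expect (p.bind q) f = expect p fun a => expect (q a) f := by
  simp only [expect, PMF.bind_apply, ← ENNReal.tsum_mul_left, ← ENNReal.tsum_mul_right]
  rw [ENNReal.tsum_comm]
  exact tsum_congr fun b => tsum_congr fun a => mul_assoc _ _ _

theorem expect_uniform [Fintype α] [Nonempty α] (f : α → ℝ≥0∞) :
    expect (PMF.uniformOfFintype α) f = (Fintype.card α : ℝ≥0∞)⁻¹ * ∑ a, f a := by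
  simp [expect, tsum_fintype, Finset.mul_sum]

open Classical in
theorem expect_uniform_eq [Fintype α] [Nonempty α] (a : α) :
    (expect (PMF.uniformOfFintype α) fun b => if a = b then 1 else 0)
      = (Fintype.card α : ℝ≥0∞)⁻¹ := by
  rw [expect_uniform]
  simp

theorem expect_uniform_bool_not (f : Bool → ℝ≥0∞) :
    (expect (PMF.uniformOfFintype Bool) fun b => f (!b))
      = expect (PMF.uniformOfFintype Bool) f := by
  simp [expect_uniform, add_comm]

theorem eq_of_statDist_nonpos {p q : PMF α} (h : statDist p q ≤ 0) : p = q := by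
  have hs : ∀ r : PMF α, Summable fun a => (r a).toReal := fun r =>
    ENNReal.summable_toReal r.tsum_coe_ne_top
  have hd : Summable fun a => |(p a).toReal - (q a).toReal| := ((hs p).sub (hs q)).abs
  have h0 : ∑' a, |(p a).toReal - (q a).toReal| = 0 :=
    le_antisymm (by unfold statDist at h; linarith) (tsum_nonneg fun a => abs_nonneg _)
  rw [← hd.hasSum_iff, hasSum_zero_iff_of_nonneg fun a => abs_nonneg _] at h0
  ext a
  have := congrFun h0 a
  rw [Pi.zero_apply, abs_eq_zero, sub_eq_zero] at this
  exact (ENNReal.toReal_eq_toReal_iff' (p.apply_ne_top a) (q.apply_ne_top a)).1 this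

end Expectation

/-! ### Utility under perfect privacy and reliability -/

section Game

open scoped ENNReal

variable {M Msg : Type} [Fintype M] [Nonempty M] {n t : ℕ}

open Classical in
theorem expect_game (P : Protocol M Msg n) (A : Adversary M Msg n t) (f : Outcome → ℝ≥0∞) :
    expect (game P A) f = expect (PMF.uniformOfFintype M) fun m => expect P.sCoin fun rS =>
      expect P.rCoin fun rR => expect A.coin fun rA =>
        f { guess := decide (guessed P A m rS rR rA = m)
            suc := decide (received P A m rS rR rA = some m)
            detect := decide (Detected P A m rS rR rA) } := by
  simp only [game, expect_bind, expect_pure]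

theorem sum_outcome {R : Type} [AddCommMonoid R] (f : Outcome → R) :
    ∑ o, f o = (f ⟨true, true, true⟩ + f ⟨true, true, false⟩)
      + (f ⟨true, false, true⟩ + f ⟨true, false, false⟩)
      + ((f ⟨false, true, true⟩ + f ⟨false, true, false⟩)
      + (f ⟨false, false, true⟩ + f ⟨false, false, false⟩)) := by
  let e : Bool × Bool × Bool ≃ Outcome :=
    { toFun := fun x => ⟨x.1, x.2.1, x.2.2⟩
      invFun := fun o => (o.guess, o.suc, o.detect)
      left_inv := fun _ => rfl
      right_inv := fun _ => rfl }
  rw [← e.sum_comp]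
  simp [Fintype.sum_prod_type, e]

theorem sum_toReal_game (P : Protocol M Msg n) (A : Adversary M Msg n t) :
    ∑ o, (game P A o).toReal = 1 := by
  rw [← ENNReal.toReal_sum fun o _ => (game P A).apply_ne_top o, ← tsum_fintype (L := .unconditional _),
    PMF.tsum_coe, ENNReal.toReal_one]

/-- The guess of an adversary is correct with probability `1 / |M|` under perfect privacy. -/
theorem expect_guess_of_private (P : Protocol M Msg n) (B : Adversary M Msg n t)
    (h : ∀ m₀ m₁ rA, statDist (viewDist P B m₀ rA) (viewDist P B m₁ rA) ≤ 0) :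
    (expect (game P B) fun o => if o.guess = true then 1 else 0)
      = (Fintype.card M : ℝ≥0∞)⁻¹ := by
  classical
  obtain ⟨m₀⟩ := ‹Nonempty M›
  have hv : ∀ m rA, viewDist P B m rA = viewDist P B m₀ rA := fun m rA =>
    eq_of_statDist_nonpos (h m m₀ rA)
  -- For fixed adversary coins the guess is a function of the view, whose law does not depend on
  -- `m`.
  have key : ∀ m rA, (expect P.sCoin fun rS => expect P.rCoin fun rR =>
      if guessed P B m rS rR rA = m then (1 : ℝ≥0∞) else 0)
      = expect (viewDist P B m₀ rA) fun v => if B.guess rA v = m then 1 else 0 := by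
    intro m rA
    rw [← hv m rA]
    simp only [viewDist, expect_bind, expect_pure]
    rfl
  calc _ = expect (PMF.uniformOfFintype M) fun m => expect B.coin fun rA =>
        expect P.sCoin fun rS => expect P.rCoin fun rR =>
          if guessed P B m rS rR rA = m then (1 : ℝ≥0∞) else 0 := by
        rw [expect_game]
        congr 1
        funext m
        rw [expect_comm B.coin]
        congr 1
        funext rS
        rw [expect_comm B.coin]
        simp only [decide_eq_true_eq]
    _ = (Fintype.card M : ℝ≥0∞)⁻¹ := by
        simp only [key]
        rw [expect_comm]
        have : ∀ rA, (expect (PMF.uniformOfFintype M) fun m =>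
            expect (viewDist P B m₀ rA) fun v => if B.guess rA v = m then (1 : ℝ≥0∞) else 0)
            = (Fintype.card M : ℝ≥0∞)⁻¹ := by
          intro rA
          -- Once the view is fixed, the guess is fixed while the message is still uniform.
          rw [expect_comm]
          simp only [expect_uniform_eq, expect_const]
        simp only [this, expect_const]

/-- Under perfect reliability, the transmission never fails in the game. -/
theorem game_apply_eq_zero_of_reliable (P : Protocol M Msg n) (B : Adversary M Msg n t)
    (h : ∀ m, ((outputDist P B m).toOuterMeasure {x | x ≠ some m}).toReal ≤ 0)
    (o : Outcome) (ho : o.suc = false) : game P B o = 0 := by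
  classical
  rw [PMF.apply_eq_zero_iff]
  intro hmem
  simp only [game, PMF.mem_support_bind_iff, PMF.mem_support_pure_iff] at hmem
  obtain ⟨m, -, rS, hS, rR, hR, rA, hA, rfl⟩ := hmem
  have h0 : (outputDist P B m).toOuterMeasure {x | x ≠ some m} = 0 := by
    refine ((ENNReal.toReal_eq_zero_iff _).1
      (le_antisymm (h m) ENNReal.toReal_nonneg)).resolve_right (ne_of_lt ?_)
    refine lt_of_le_of_lt ((outputDist P B m).toOuterMeasure.mono (Set.subset_univ _)) ?_
    exact lt_of_eq_of_lt ((PMF.toOuterMeasure_apply_eq_one_iff _ _).2 (Set.subset_univ _))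
      ENNReal.one_lt_top
  rw [PMF.toOuterMeasure_apply_eq_zero_iff, Set.disjoint_left] at h0
  refine h0 (a := received P B m rS rR rA) ?_ (by simpa using ho)
  simp only [outputDist, PMF.mem_support_bind_iff, PMF.mem_support_pure_iff]
  exact ⟨rS, hS, rR, hR, rA, hA, rfl⟩

theorem utilityAt_mono (M : Type) [Fintype M] [Nonempty M] {U : Outcome → ℝ} {s d s' d' : Bool}
    (h : ∀ g, U ⟨g, s, d⟩ ≤ U ⟨g, s', d'⟩) : utilityAt M U s d ≤ utilityAt M U s' d' := by
  have hc : (1 : ℝ) ≤ Fintype.card M := by exact_mod_cast Fintype.card_pos (α := M)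
  have h1 : 1 / (Fintype.card M : ℝ) ≤ 1 := (div_le_one (by linarith)).2 hc
  unfold utilityAt
  gcongr
  · exact h true
  · exact h false

/-- Privacy fixes the probability of a correct guess at `1 / |M|`, reliability removes the outcomes
without success, and detection only lowers a timid utility. -/
theorem utility_le_u₂ (P : Protocol M Msg n) (B : Adversary M Msg n t) (U : Outcome → ℝ)
    (hU : IsTimid U) (hB : IsSMTAgainst P B 0 0) : utility P B U ≤ u₂ M U := by
  have hz := fun g d => game_apply_eq_zero_of_reliable P B hB.reliability ⟨g, false, d⟩ rfl
  have hg : (∑ o : Outcome, (game P B o) * (if o.guess = true then 1 else 0))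
      = (Fintype.card M : ℝ≥0∞)⁻¹ := by
    rw [← expect_guess_of_private P B hB.privacy, expect, tsum_fintype]
  have hg' := congrArg ENNReal.toReal hg
  have h1 := sum_toReal_game P B
  rw [sum_outcome] at hg' h1
  simp only [hz, ENNReal.toReal_zero, if_true, mul_one, mul_zero, add_zero, Bool.false_eq_true,
    if_false, ENNReal.toReal_add (PMF.apply_ne_top _ _) (PMF.apply_ne_top _ _),
    ENNReal.toReal_inv, ENNReal.toReal_natCast] at hg' h1
  have ht : ∀ g, U ⟨g, true, true⟩ < U ⟨g, true, false⟩ := fun g =>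
    hU.prefers_undetected _ _ rfl rfl Bool.false_lt_true
  -- Writing `1 / |M|` as the mass of the correct guesses turns the claim into a termwise
  -- comparison.
  rw [utility, sum_outcome, u₂, utilityAt, one_div, ← hg']
  simp only [hz, ENNReal.toReal_zero, zero_mul, add_zero]
  have h2 : 1 - ((game P B ⟨true, true, true⟩).toReal + (game P B ⟨true, true, false⟩).toReal)
      = (game P B ⟨false, true, true⟩).toReal + (game P B ⟨false, true, false⟩).toReal := by
    linarith
  rw [h2]
  have a1 := mul_le_mul_of_nonneg_left (ht true).le
    (ENNReal.toReal_nonneg (a := game P B ⟨true, true, true⟩))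
  have a2 := mul_le_mul_of_nonneg_left (ht false).le
    (ENNReal.toReal_nonneg (a := game P B ⟨false, true, true⟩))
  linarith

end Game

/-! ### The impersonating adversary -/

section Impersonation

open scoped ENNReal

variable {M Msg : Type} {n t : ℕ}

/-- The empty packet. -/
def Packet.blank : Packet Msg := ⟨none, false⟩

/-- What a sender would have heard when the packets visible in `V` arrive and the other channels
are blocked. -/
def Protocol.overheard (P : Protocol M Msg n) (V : List (Glimpse n Msg)) : List (Row n Msg) :=
  -- A view has one entry per round, so the position of a glimpse is its round number.
  (V.zipIdx.filter fun g => P.speaker g.2 ≠ .sender).map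
    fun g i => (g.1 i).getD Packet.blank

/-- The distribution of a uniformly random message together with coins of the sender. -/
noncomputable def Protocol.senderCoins [Fintype M] [Nonempty M] (P : Protocol M Msg n) :
    PMF (M × P.SCoin) :=
  (PMF.uniformOfFintype M).bind fun m => P.sCoin.bind fun rS => PMF.pure (m, rS)

/-- One of the two sides of the partition of the channels into `I` and its complement. -/
def side (I : Finset (Fin n)) (b : Bool) : Finset (Fin n) := if b then I else Iᶜ

theorem mem_side_not (I : Finset (Fin n)) (b : Bool) (i : Fin n) :
    i ∈ side I (!b) ↔ i ∉ side I b := by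
  cases b <;> simp [side]

/-- With coins `r`, the adversary `A` sends over the corrupted channels what a sender with message
and coins `a` would send, and blocks what the receiver sends there. -/
def Impersonates (P : Protocol M Msg n) (A : Adversary M Msg n t) (r : A.Coin)
    (a : M × P.SCoin) : Prop :=
  ∀ V, A.tamper r V = match P.speaker (V.length - 1) with
    | .sender => P.sSend a.1 a.2 (V.length - 1) (P.overheard V)
    | .receiver => fun _ => Packet.blank

/-- The adversary which corrupts a random one of the two sides of a partition of the channels,
impersonates there a sender of a random message, blocks what the receiver sends over the corrupted
channels, and outputs a random guess. -/
noncomputable def impersonator [Fintype M] [Nonempty M] (P : Protocol M Msg n)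
    (I : Finset (Fin n)) (hI : ∀ b, (side I b).card ≤ t) : Adversary M Msg n t where
  Coin := (M × P.SCoin) × Bool × M
  coin := P.senderCoins.bind fun a => (PMF.uniformOfFintype Bool).bind fun b =>
    (PMF.uniformOfFintype M).bind fun g => PMF.pure (a, b, g)
  corrupt r := side I r.2.1
  card_corrupt_le r := hI r.2.1
  -- `V` already contains the current round, hence `V.length - 1`; in a sender round `overheard`
  -- drops that last entry.
  tamper r V := match P.speaker (V.length - 1) with
    | .sender => P.sSend r.1.1 r.1.2 (V.length - 1) (P.overheard V)
    | .receiver => fun _ => Packet.blank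
  guess r _ := r.2.2

theorem length_run (P : Protocol M Msg n) (A : Adversary M Msg n t) (m : M) (rS : P.SCoin)
    (rR : P.RCoin) (rA : A.Coin) (k : ℕ) : (run P A m rS rR rA k).length = k := by
  induction k with
  | zero => rfl
  | succ k ih => simp [run, ih]

theorem heard_append_singleton (p : Party) (T : List (Exchange n Msg)) (e : Exchange n Msg) :
    heard p (T ++ [e]) = heard p T ++ if e.speaker ≠ p then [e.delivered] else [] := by
  by_cases h : e.speaker = p <;> simp [heard, h]

theorem Protocol.overheard_append_singleton (P : Protocol M Msg n) (V : List (Glimpse n Msg))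
    (g : Glimpse n Msg) : P.overheard (V ++ [g]) = P.overheard V ++
      if P.speaker V.length ≠ .sender then [fun i => (g i).getD Packet.blank] else [] := by
  by_cases h : P.speaker V.length = .sender <;> simp [Protocol.overheard, List.zipIdx_append, h]

/-- Two executions in which the sender of each is impersonated in the other, over complementary
sets of channels, cannot be told apart by the receiver. -/
theorem heard_run_eq_of_impersonation (P : Protocol M Msg n) (A : Adversary M Msg n t)
    {a a' : M × P.SCoin} {r r' : A.Coin} (hc : ∀ i, i ∈ A.corrupt r' ↔ i ∉ A.corrupt r)
    (hr : Impersonates P A r a') (hr' : Impersonates P A r' a) (rR : P.RCoin) (k : ℕ) :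
    let T := run P A a.1 a.2 rR r k
    let T' := run P A a'.1 a'.2 rR r' k
    heard .receiver T = heard .receiver T' ∧
      heard .sender T' = P.overheard (A.view r T) ∧
      heard .sender T = P.overheard (A.view r' T') := by
  induction k with
  | zero => exact ⟨rfl, rfl, rfl⟩
  | succ k ih =>
    obtain ⟨h1, h2, h3⟩ := ih
    simp only [run]
    set T := run P A a.1 a.2 rR r k with hT
    set T' := run P A a'.1 a'.2 rR r' k with hT'
    have hl : (A.view r T).length = k := by simp [Adversary.view, hT, length_run]
    have hl' : (A.view r' T').length = k := by simp [Adversary.view, hT', length_run]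
    have hview : ∀ r (S : List (Exchange n Msg)) e,
        A.view r (S ++ [e]) = A.view r S ++ [glimpse (A.corrupt r) e.sent] := fun r S e => by
      simp [Adversary.view]
    simp only [heard_append_singleton, hview, Protocol.overheard_append_singleton, hl, hl',
      Protocol.send]
    unfold Impersonates at hr hr'
    rcases hs : P.speaker k with _ | _
    -- Sender round: on each channel one run carries the true packet and the other its simulation,
    -- computed from equal histories.
    · simp only [h1, ← h2, ← h3, ne_eq, not_true_eq_false, if_false, List.append_nil, reduceCtorEq,
        not_false_eq_true, if_true, and_true]
      congr 2
      funext i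
      by_cases hi : i ∈ A.corrupt r <;>
        simp [Adversary.deliver, hi, hc, hr, hr', hl, hl', hs, h2, h3,
          Protocol.overheard_append_singleton]
    -- Receiver round: the channels blocked for the true sender of one run are those invisible to
    -- its simulation in the other, and both count as blank.
    · simp only [h1, h2, h3, ne_eq, not_true_eq_false, if_false, List.append_nil, reduceCtorEq,
        not_false_eq_true, if_true, true_and]
      constructor <;> congr 2 <;> funext i <;> by_cases hi : i ∈ A.corrupt r <;>
        simp [Adversary.deliver, hi, hc, hr, hr', hl, hl', hs, glimpse]

/-! ### Success probability and utility of the impersonator -/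

variable [Fintype M] [Nonempty M]

/-- Exchanging the roles of the sender and of the impersonated sender, as well as the two sides,
does not change what the receiver outputs. -/
theorem received_impersonator_swap (P : Protocol M Msg n) (I : Finset (Fin n))
    (hI : ∀ b, (side I b).card ≤ t) (a a' : M × P.SCoin) (b : Bool) (g : M) (rR : P.RCoin) :
    received P (impersonator P I hI) a.1 a.2 rR (a', b, g)
      = received P (impersonator P I hI) a'.1 a'.2 rR (a, !b, g) :=
  congrArg (P.output rR) (heard_run_eq_of_impersonation P (impersonator P I hI)
    (r := (a', b, g)) (r' := (a, !b, g)) (mem_side_not I b) (fun _ => rfl) (fun _ => rfl)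
    rR P.rounds).1

theorem run_impersonator_congr_guess (P : Protocol M Msg n) (I : Finset (Fin n))
    (hI : ∀ b, (side I b).card ≤ t) (m : M) (rS : P.SCoin) (rR : P.RCoin) (a' : M × P.SCoin)
    (b : Bool) (g g' : M) (k : ℕ) :
    run P (impersonator P I hI) m rS rR (a', b, g) k
      = run P (impersonator P I hI) m rS rR (a', b, g') k := by
  induction k with
  | zero => rfl
  | succ k ih =>
    simp only [run, ih]
    rfl

theorem expect_senderCoins (P : Protocol M Msg n) (f : M × P.SCoin → ℝ≥0∞) :
    expect P.senderCoins f = expect (PMF.uniformOfFintype M) fun m =>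
      expect P.sCoin fun rS => f (m, rS) := by
  simp only [Protocol.senderCoins, expect_bind, expect_pure]

open Classical in
theorem expect_game_impersonator (P : Protocol M Msg n) (I : Finset (Fin n))
    (hI : ∀ b, (side I b).card ≤ t) (f : Outcome → ℝ≥0∞) :
    expect (game P (impersonator P I hI)) f = expect P.senderCoins fun a =>
      expect P.rCoin fun rR => expect P.senderCoins fun a' =>
        expect (PMF.uniformOfFintype Bool) fun b => expect (PMF.uniformOfFintype M) fun g =>
        f { guess := decide (g = a.1)
            suc := decide (received P (impersonator P I hI) a.1 a.2 rR (a', b, g) = some a.1)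
            detect := decide (Detected P (impersonator P I hI) a.1 a.2 rR (a', b, g)) } := by
  rw [expect_game, expect_senderCoins]
  simp only [impersonator, expect_bind, expect_pure]
  rfl

open Classical in
/-- The impersonator lets the transmission succeed with probability at most
`(1 + 1 / |M|) / 2`. -/
theorem two_mul_expect_suc_impersonator_le (P : Protocol M Msg n) (I : Finset (Fin n))
    (hI : ∀ b, (side I b).card ≤ t) :
    2 * (expect (game P (impersonator P I hI)) fun o => if o.suc = true then 1 else 0)
      ≤ 1 + (Fintype.card M : ℝ≥0∞)⁻¹ := by
  set A := impersonator P I hI with hA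
  let S : M × P.SCoin → M × P.SCoin → P.RCoin → Bool → M → ℝ≥0∞ := fun a a' rR b g =>
    if received P A a.1 a.2 rR (a', b, g) = some a.1 then 1 else 0
  let E : (M × P.SCoin → M × P.SCoin → P.RCoin → Bool → M → ℝ≥0∞) → ℝ≥0∞ := fun F =>
    expect P.rCoin fun rR => expect P.senderCoins fun a => expect P.senderCoins fun a' =>
      expect (PMF.uniformOfFintype Bool) fun b => expect (PMF.uniformOfFintype M) fun g =>
        F a a' rR b g
  have h1 : (expect (game P A) fun o => if o.suc = true then 1 else 0) = E S := by
    rw [hA, expect_game_impersonator, expect_comm]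
    simp only [decide_eq_true_eq]
    rfl
  -- `a` and `a'` are independent and identically distributed, and the side is a fair bit.
  have h2 : E S = E fun a a' rR b g => S a' a rR (!b) g := by
    simp only [E]
    congr 1
    funext rR
    rw [expect_comm]
    congr 1
    funext a'
    congr 1
    funext a
    exact (expect_uniform_bool_not fun b => expect _ fun g => S a a' rR b g).symm
  -- The paired runs give the same output, so both succeed only if the messages agree; this has
  -- probability `1 / |M|`.
  have hle : ∀ a a' rR b g, S a a' rR b g + S a' a rR (!b) g
      ≤ 1 + if a.1 = a'.1 then 1 else 0 := by
    intro a a' rR b g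
    by_cases h : a.1 = a'.1
    · rw [if_pos h]
      simp only [S]
      gcongr <;> split_ifs <;> simp
    · rw [if_neg h, add_zero]
      by_cases h3 : received P A a.1 a.2 rR (a', b, g) = some a.1
      · have h4 : received P A a'.1 a'.2 rR (a, !b, g) ≠ some a'.1 := fun h4 =>
          h (Option.some.inj (h3.symm.trans
            ((received_impersonator_swap P I hI a a' b g rR).trans h4)))
        simp [S, h3, h4]
      · simp only [S, if_neg h3, zero_add]
        split_ifs <;> simp
  calc _ = (E S) + E fun a a' rR b g => S a' a rR (!b) g := by rw [h1, ← h2, two_mul]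
    _ = E fun a a' rR b g => S a a' rR b g + S a' a rR (!b) g := by
        simp only [E, expect_add]
    _ ≤ E fun a a' _ _ _ => 1 + if a.1 = a'.1 then 1 else 0 :=
        expect_mono _ fun rR => expect_mono _ fun a => expect_mono _ fun a' =>
          expect_mono _ fun b => expect_mono _ fun g => hle a a' rR b g
    _ = 1 + (Fintype.card M : ℝ≥0∞)⁻¹ := by
        simp only [E, expect_add, expect_const]
        congr 1
        let δ : M → M → ℝ≥0∞ := fun x y => if x = y then 1 else 0
        change (expect P.senderCoins fun a => expect P.senderCoins fun a' => δ a.1 a'.1) = _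
        simp only [expect_senderCoins, expect_const]
        simp only [δ, expect_uniform_eq, expect_const]

/-- The guess of the impersonator is independent of success and detection. -/
theorem card_mul_game_impersonator (P : Protocol M Msg n) (I : Finset (Fin n))
    (hI : ∀ b, (side I b).card ≤ t) (s d : Bool) :
    (Fintype.card M : ℝ≥0∞) * game P (impersonator P I hI) ⟨true, s, d⟩
      = game P (impersonator P I hI) ⟨true, s, d⟩
        + game P (impersonator P I hI) ⟨false, s, d⟩ := by
  classical
  simp only [apply_eq_expect (game P _), expect_game_impersonator]
  simp only [← expect_const_mul, ← expect_add]
  refine congrArg _ (funext fun a => congrArg _ (funext fun rR => congrArg _ (funext fun a' =>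
    congrArg _ (funext fun b => ?_))))
  -- The coin `g` affects only the final guess, so inside the run it may be frozen at `a.1`; success
  -- and detection then become constants in `g`.
  simp only [received, Detected, exec, run_impersonator_congr_guess P I hI _ _ _ _ _ _ a.1]
  generalize decide (P.output rR _ = some a.1) = s'
  generalize decide (∃ e ∈ run P (impersonator P I hI) a.1 a.2 rR (a', b, a.1) P.rounds,
    ∃ i, (e.sent i).detect = true) = d'
  rw [expect_const_mul]
  by_cases h : s = s' ∧ d = d'
  · have h1 : (fun g => if (⟨true, s, d⟩ : Outcome) = ⟨decide (g = a.1), s', d'⟩ then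
        (1 : ℝ≥0∞) else 0) = fun g => if a.1 = g then 1 else 0 := by
      funext g
      simp [h, eq_comm]
    have h2 : (fun g => (if (⟨true, s, d⟩ : Outcome) = ⟨decide (g = a.1), s', d'⟩ then
        (1 : ℝ≥0∞) else 0) + if (⟨false, s, d⟩ : Outcome) = ⟨decide (g = a.1), s', d'⟩ then
        (1 : ℝ≥0∞) else 0) = fun _ => 1 := by
      funext g
      by_cases hg : g = a.1 <;> simp [h, hg]
    rw [h1, h2, expect_uniform_eq, expect_const,
      ENNReal.mul_inv_cancel (by simp) (ENNReal.natCast_ne_top _)]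
  · have h1 : ∀ x y, (⟨x, s, d⟩ : Outcome) ≠ ⟨y, s', d'⟩ := fun x y e => h (by simp_all)
    simp [h1, expect_const]

theorem le_utility_impersonator (P : Protocol M Msg n) (I : Finset (Fin n))
    (hI : ∀ b, (side I b).card ≤ t) (U : Outcome → ℝ) (hU : IsTimid U) (hU₄ : 0 ≤ u₄ M U) :
    (1 / 2) * (1 - 1 / (Fintype.card M : ℝ)) * u₃ M U
      ≤ utility P (impersonator P I hI) U := by
  classical
  set A := impersonator P I hI with hA
  set c : ℝ := ((Fintype.card M : ℕ) : ℝ) with hc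
  have hc1 : 1 ≤ c := by
    rw [hc]
    exact_mod_cast Fintype.card_pos (α := M)
  set p : Bool → Bool → Bool → ℝ := fun g s d => (game P A ⟨g, s, d⟩).toReal with hp
  have hp0 : ∀ g s d, 0 ≤ p g s d := fun g s d => ENNReal.toReal_nonneg
  have hq : ∀ s d, c * p true s d = p true s d + p false s d := fun s d => by
    have := congrArg ENNReal.toReal (card_mul_game_impersonator P I hI s d)
    rwa [ENNReal.toReal_mul, ENNReal.toReal_natCast,
      ENNReal.toReal_add (PMF.apply_ne_top _ _) (PMF.apply_ne_top _ _)] at this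
  have h1 := sum_toReal_game P A
  have h2 : 2 * (p true true true + p true true false + (p false true true + p false true false))
      ≤ 1 + 1 / c := by
    have := two_mul_expect_suc_impersonator_le P I hI
    rw [expect, tsum_fintype, sum_outcome] at this
    have := ENNReal.toReal_mono (by simp) this
    simpa [ENNReal.toReal_add, PMF.apply_ne_top, hp, hc] using this
  rw [sum_outcome] at h1
  -- By independence of the guess, `c * p true s d` is the probability of `suc = s` and `detect =
  -- d`.
  have hu : utility P A U = (∑ s, ∑ d, c * p true s d * utilityAt M U s d) := by
    have : ∀ s d, c * p true s d * utilityAt M U s d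
        = p true s d * U ⟨true, s, d⟩ + p false s d * U ⟨false, s, d⟩ := fun s d => by
      have hf : p false s d = (c - 1) * p true s d := by linarith [hq s d]
      rw [utilityAt, hf, ← hc]
      field_simp
    simp only [this]
    simp only [utility, sum_outcome, Fintype.sum_bool, hp]
    ring
  have h43 : u₄ M U ≤ u₃ M U := utilityAt_mono M fun g =>
    (hU.prefers_failure ⟨g, false, true⟩ ⟨g, true, true⟩ rfl Bool.false_lt_true rfl).le
  have h42 : u₄ M U ≤ utilityAt M U true false := utilityAt_mono M fun g =>
    (hU.prefers_undetected ⟨g, true, false⟩ ⟨g, true, true⟩ rfl rfl Bool.false_lt_true).le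
  have h31 : u₃ M U ≤ utilityAt M U false false := utilityAt_mono M fun g =>
    (hU.prefers_undetected ⟨g, false, false⟩ ⟨g, false, true⟩ rfl rfl Bool.false_lt_true).le
  rw [hu]
  simp only [Fintype.sum_bool]
  have hpc : ∀ s d, 0 ≤ c * p true s d := fun s d => by have := hp0 true s d; positivity
  have e1 := mul_nonneg (hpc true true) hU₄
  have e2 := mul_nonneg (hpc true false) (hU₄.trans h42)
  have e3 := mul_le_mul_of_nonneg_left h31 (hpc false false)
  -- The failure probability is at least `1 - (1 + 1 / c) / 2`.
  have e4 : (1 / 2) * (1 - 1 / c) ≤ c * p true false true + c * p true false false := by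
    rw [hq, hq]
    simp only [hp] at h2 ⊢
    linarith
  have e5 := mul_le_mul_of_nonneg_right e4 (hU₄.trans h43)
  unfold u₃ u₄ at *
  linarith

end Impersonation

theorem exists_side_card_le {n t : ℕ} (h : n ≤ 2 * t) :
    ∃ I : Finset (Fin n), ∀ b, (side I b).card ≤ t := by
  -- The minimum covers `t > n`; otherwise the complement has `n - t ≤ t` channels.
  obtain ⟨I, -, hI⟩ := Finset.exists_subset_card_eq
    (s := (Finset.univ : Finset (Fin n))) (n := min t n) (by simp)
  refine ⟨I, fun b => ?_⟩
  cases b <;> simp [side, Finset.card_compl, hI]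
  omega

end SMT

theorem mainTheorem3 {M Msg : Type} [Fintype M] [Nonempty M] {n t : ℕ}
    (P : SMT.Protocol M Msg n) (U : SMT.Outcome → ℝ) (hU : SMT.IsTimid U)
    (hU₄ : 0 ≤ SMT.u₄ M U)
    (hP : SMT.PerfectlySecureAgainstRational P t U)
    (hu : SMT.u₂ M U < (1 / 2) * (1 - 1 / (Fintype.card M : ℝ)) * SMT.u₃ M U) :
    (t : ℝ) < (n : ℝ) / 2 := by
  by_contra hlt
  have hn : n ≤ 2 * t := by
    have : (n : ℝ) ≤ 2 * t := by linarith
    exact_mod_cast this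
  obtain ⟨I, hI⟩ := SMT.exists_side_card_le hn
  obtain ⟨B, hB, hmax⟩ := hP
  have h1 := hmax (SMT.impersonator P I hI)
  have h2 := SMT.utility_le_u₂ P B U hU hB
  have h3 := SMT.le_utility_impersonator P I hI U hU hU₄
  linarith
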